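/- Let $w=(w_k)_{k\in\mathbb Z}$ be a complex sequence with $\overline{w_{-k}}=w_k$ for all $k\in\mathbb Z$ and such that, for some constant $C$, $|w_k|<C/|k|^3$ for all $k\neq 0$. Let $v=(v_n)_{n\in\mathbb Z}$ be a bounded real sequence, and let $H$ be the bounded self-adjoint operator on $\ell^2(\mathbb Z)$ given by $$(Hu)_n=\sum_{k\in\mathbb Z}w_k u_{n+k}+v_n u_n,\qquad n\in\mathbb Z.$$ Let $S\subset\mathbb R$ be a Lebesgue measurable set of positive Lebesgue measure such that for every $E\in S$ there is a bounded sequence $u:\mathbb Z\to\mathbb C$, $u\not\equiv 0$ (not necessarily in $\ell^2(\mathbb Z)$), with $\sum_{k}w_k u_{n+k}+v_nu_n=Eu_n$ for all $n\in\mathbb Z$. Then, up to a Lebesgue null set, $S$ is contained in the essential support of the absolutely continuous spectrum of $H$. Here, for $\phi\in\ell^2(\mathbb Z)$, let $\mu_\phi$ be the spectral measure of $H$ at $\phi$ and $\mu_{\phi,ac}$ its absolutely continuous part with respect to Lebesgue measure $|\cdot|$. A Borel set $A\subset\mathbb R$ is an essential support of the absolutely continuous spectrum of $H$ if $\mu_{\phi,ac}(\mathbb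 R\setminus A)=0$ for every $\phi\in\ell^2(\mathbb Z)$, and $|A\setminus T|=0$ for every Borel set $T$ with $\mu_{\phi,ac}(\mathbb R\setminus T)=0$ for every $\phi\in\ell^2(\mathbb Z)$. Explicitly, the claim is that such a set $A$ exists, and that $|S\setminus A|=0$ for every such $A$. -/

import Mathlib

open MeasureTheory
open scoped ENNReal

noncomputable section

/-- The Hilbert space `ℓ²(ℤ)` of square summable complex sequences indexed by `ℤ`. -/
abbrev EllTwo : Type := lp (fun _ : ℤ => ℂ) 2

/-- The formal long-range action `n ↦ ∑ₖ wₖ u_{n+k} + vₙ uₙ` on an arbitrary sequence `u`.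
The series converges absolutely when `w` is summable and `u` is bounded. -/
def longRangeAction (w : ℤ → ℂ) (v : ℤ → ℝ) (u : ℤ → ℂ) (n : ℤ) : ℂ :=
  (∑' k : ℤ, w k * u (n + k)) + (v n : ℂ) * u n

/-- `|wₖ| < C / |k|³` for all `k ≠ 0`, for some constant `C`. -/
def CubicDecay (w : ℤ → ℂ) : Prop :=
  ∃ C : ℝ, ∀ k : ℤ, k ≠ 0 → ‖w k‖ < C / |(k : ℝ)| ^ 3

theorem CubicDecay.summable {w : ℤ → ℂ} (hw : CubicDecay w) : Summable fun k => ‖w k‖ := by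
  obtain ⟨C, hC⟩ := hw
  have h1 : Summable fun k : ℤ => |(k : ℝ)| ^ (-3 : ℝ) :=
    Real.summable_abs_int_rpow (by norm_num)
  refine Summable.of_norm_bounded_eventually (h1.mul_left C) ?_
  have : ({0} : Set ℤ)ᶜ ∈ (Filter.cofinite : Filter ℤ) := (Set.finite_singleton 0).compl_mem_cofinite
  filter_upwards [this] with k hk
  have h2 := (hC k hk).le
  rw [Real.rpow_neg (abs_nonneg _), show (3 : ℝ) = ((3 : ℕ) : ℝ) by norm_num, Real.rpow_natCast]
  simpa [div_eq_mul_inv] using h2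

/-- The shift `(S_k u)_n = u_{n+k}` on `ℓ²(ℤ)`. -/
def shiftTwo (k : ℤ) : EllTwo →L[ℂ] EllTwo :=
  LinearMap.mkContinuous
    { toFun := fun u => ⟨fun n => u (n + k), by
        have h := (memℓp_gen_iff (by norm_num : 0 < (2 : ℝ≥0∞).toReal)).1 (lp.memℓp u)
        exact memℓp_gen ((Equiv.addRight k).summable_iff.2 h)⟩
      map_add' := fun u u' => by ext n; rfl
      map_smul' := fun c u => by ext n; rfl }
    1 (fun u => by
      have h2 : 0 < (2 : ℝ≥0∞).toReal := by norm_num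
      rw [one_mul, lp.norm_eq_tsum_rpow h2, lp.norm_eq_tsum_rpow h2]
      exact le_of_eq (congrArg (fun t : ℝ => t ^ (1 / (2 : ℝ≥0∞).toReal))
        ((Equiv.addRight k).tsum_eq fun n => ‖u n‖ ^ (2 : ℝ≥0∞).toReal)))

theorem shiftTwo_norm_le (k : ℤ) : ‖shiftTwo k‖ ≤ 1 :=
  LinearMap.mkContinuous_norm_le _ zero_le_one _

/-- Multiplication by a bounded real potential, `(V u)_n = vₙ uₙ`, on `ℓ²(ℤ)`. -/
def potentialTwo (v : ℤ → ℝ) (hv : ∃ M : ℝ, ∀ n, |v n| ≤ M) : EllTwo →L[ℂ] EllTwo :=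
  have key : ∀ (u : EllTwo) (n : ℤ), ‖(v n : ℂ) * u n‖ ≤ ‖((hv.choose : ℂ) • u : EllTwo) n‖ := by
    intro u n
    have h := (hv.choose_spec n).trans (le_abs_self _)
    rw [lp.coeFn_smul, Pi.smul_apply, norm_smul, norm_mul, Complex.norm_real, Complex.norm_real]
    exact mul_le_mul_of_nonneg_right h (norm_nonneg (u n))
  LinearMap.mkContinuous
    { toFun := fun u =>
        ⟨fun n => (v n : ℂ) * u n, (lp.memℓp ((hv.choose : ℂ) • u)).mono' (key u)⟩
      map_add' := fun u u' => by ext n; exact mul_add _ _ _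
      map_smul' := fun c u => by ext n; exact mul_left_comm _ _ _ }
    |hv.choose| (fun u => by
      refine (lp.norm_mono (p := 2) (by norm_num) (y := (hv.choose : ℂ) • u)
        (key u)).trans (le_of_eq ?_)
      rw [norm_smul, Complex.norm_real, Real.norm_eq_abs])

/-- The long-range operator `(H u)_n = ∑ₖ wₖ u_{n+k} + vₙ uₙ` as a bounded operator on `ℓ²(ℤ)`,
written as the operator-norm convergent series `∑ₖ wₖ S_k` plus the potential (for summable `w`;
see `longRangeOperator_apply`). -/
def longRangeOperator (w : ℤ → ℂ) (v : ℤ → ℝ) (hv : ∃ M : ℝ, ∀ n, |v n| ≤ M) :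
    EllTwo →L[ℂ] EllTwo :=
  (∑' k : ℤ, w k • shiftTwo k) + potentialTwo v hv

theorem summable_smul_shiftTwo {w : ℤ → ℂ} (hw : CubicDecay w) :
    Summable fun k => w k • shiftTwo k := by
  refine Summable.of_norm_bounded hw.summable fun k => ?_
  rw [norm_smul]
  exact mul_le_of_le_one_right (norm_nonneg _) (shiftTwo_norm_le k)

theorem longRangeOperator_apply {w : ℤ → ℂ} (hw : CubicDecay w) (v : ℤ → ℝ)
    (hv : ∃ M : ℝ, ∀ n, |v n| ≤ M) (u : EllTwo) (n : ℤ) :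
    longRangeOperator w v hv u n = longRangeAction w v u n := by
  have h1 := (summable_smul_shiftTwo hw).hasSum
  have h2 := (h1.mapL (ContinuousLinearMap.apply ℂ EllTwo u)).mapL
    (lp.evalCLM ℂ (fun _ : ℤ => ℂ) 2 n)
  exact congrArg (· + (v n : ℂ) * u n) h2.tsum_eq.symm

theorem longRangeOperator_isSelfAdjoint {w : ℤ → ℂ}
    (hsymm : ∀ k, star (w (-k)) = w k) (v : ℤ → ℝ) (hv : ∃ M : ℝ, ∀ n, |v n| ≤ M) :
    IsSelfAdjoint (longRangeOperator w v hv) := by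
  have hS : ∀ k, star (shiftTwo k) = shiftTwo (-k) := by
    intro k
    rw [ContinuousLinearMap.star_eq_adjoint, eq_comm, ContinuousLinearMap.eq_adjoint_iff]
    intro x y
    rw [lp.inner_eq_tsum, lp.inner_eq_tsum, ← (Equiv.addRight k).tsum_eq]
    refine tsum_congr fun n => ?_
    change inner ℂ (x (n + k + -k)) (y (n + k)) = inner ℂ (x n) (y (n + k))
    rw [add_neg_cancel_right]
  have hV : star (potentialTwo v hv) = potentialTwo v hv := by
    rw [ContinuousLinearMap.star_eq_adjoint, eq_comm, ContinuousLinearMap.eq_adjoint_iff]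
    intro x y
    rw [lp.inner_eq_tsum, lp.inner_eq_tsum]
    refine tsum_congr fun n => ?_
    change inner ℂ ((v n : ℂ) * x n) (y n) = inner ℂ (x n) ((v n : ℂ) * y n)
    simp only [RCLike.inner_apply, map_mul, Complex.conj_ofReal]
    ring
  rw [IsSelfAdjoint, longRangeOperator, star_add, hV]
  congr 1
  rw [tsum_star, ← (Equiv.neg ℤ).tsum_eq]
  refine tsum_congr fun k => ?_
  rw [Equiv.neg_apply, star_smul, hS, neg_neg, hsymm]

/-- `u` is a nontrivial bounded solution of `H u = E u`, i.e. a nontrivial bounded generalized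
eigenfunction at energy `E`; it is not required to lie in `ℓ²(ℤ)`. -/
structure IsBoundedSolution (w : ℤ → ℂ) (v : ℤ → ℝ) (E : ℝ) (u : ℤ → ℂ) : Prop where
  ne_zero : u ≠ 0
  bounded : ∃ M : ℝ, ∀ n, ‖u n‖ ≤ M
  eigen : ∀ n, longRangeAction w v u n = (E : ℂ) * u n

section Spectral

variable {K : Type*} [NormedAddCommGroup K] [InnerProductSpace ℂ K] [CompleteSpace K]

/-- The positive linear functional `f ↦ ⟨φ, f(H) φ⟩` on `C_c(ℝ)`, where `f(H)` is given by the
continuous functional calculus of a bounded self-adjoint operator `H`. -/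
def spectralFunctional (H : K →L[ℂ] K) (φ : K) : CompactlySupportedContinuousMap ℝ ℝ →ₚ[ℝ] ℝ :=
  PositiveLinearMap.mk₀
    { toFun := fun f => (inner ℂ φ (cfc (fun x : ℝ => f x) H φ)).re
      map_add' := fun f g => by
        have h := cfc_add (R := ℝ) (a := H) (fun x => f x) (fun x => g x)
          f.continuous.continuousOn g.continuous.continuousOn
        simp only [CompactlySupportedContinuousMap.coe_add, Pi.add_apply]
        rw [h, add_apply, inner_add_right, Complex.add_re]
      map_smul' := fun c f => by
        have h := cfc_smul (R := ℝ) (a := H) c (fun x => f x) f.continuous.continuousOn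
        simp only [CompactlySupportedContinuousMap.coe_smul, Pi.smul_apply]
        rw [h, smul_apply, inner_smul_right_eq_smul, Complex.smul_re]
        rfl }
    (fun f hf => by
      have h : (0 : K →L[ℂ] K) ≤ cfc (fun x : ℝ => f x) H := cfc_nonneg fun x _ => hf x
      have h2 := (ContinuousLinearMap.nonneg_iff_isPositive _).1 h
      exact (Complex.le_def.1 (h2.inner_nonneg_right φ)).1)

/-- The spectral measure `μ_φ` of the self-adjoint operator `H` at the vector `φ`: the unique
regular Borel measure on `ℝ` with `∫ f dμ_φ = ⟨φ, f(H) φ⟩` for all `f ∈ C_c(ℝ)`. -/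
def spectralMeasure (H : K →L[ℂ] K) (φ : K) : Measure ℝ :=
  RealRMK.rieszMeasure (spectralFunctional H φ)

theorem integral_spectralMeasure (H : K →L[ℂ] K) (φ : K) (f : CompactlySupportedContinuousMap ℝ ℝ) :
    ∫ x, f x ∂(spectralMeasure H φ) = (inner ℂ φ (cfc (fun x : ℝ => f x) H φ)).re :=
  RealRMK.integral_rieszMeasure _ f

/-- The absolutely continuous part, in the Lebesgue decomposition with respect to Lebesgue
measure, of the spectral measure of `H` at `φ`. -/
def acSpectralMeasure (H : K →L[ℂ] K) (φ : K) : Measure ℝ :=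
  (volume : Measure ℝ).withDensity ((spectralMeasure H φ).rnDeriv volume)

/-- A Borel set carries the absolutely continuous spectrum of `H` if the absolutely continuous
part of every spectral measure vanishes off it. -/
def CarriesAC (H : K →L[ℂ] K) (A : Set ℝ) : Prop :=
  MeasurableSet A ∧ ∀ φ : K, acSpectralMeasure H φ Aᶜ = 0

/-- `A` is an essential support of the absolutely continuous spectrum of `H`: it carries the
absolutely continuous spectrum and, up to Lebesgue null sets, is contained in every Borel set
that does so. Such a set is unique up to Lebesgue null sets. -/
def IsACEssentialSupport (H : K →L[ℂ] K) (A : Set ℝ) : Prop :=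
  CarriesAC H A ∧ ∀ T : Set ℝ, CarriesAC H T → volume (A \ T) = 0

end Spectral

end

/-! Fix `E ∈ S`, a bounded solution `u` and a site `m` with `u m ≠ 0`, and let `μ` be the spectral
measure of `δ_m`. Let `ψ` be `u` times the cutoff `(1 - ε)^|n - m|`. In `(H - E)ψ` the eigenvalue
equation cancels everything but a commutator with the cutoff, which the finite first moment of `w`
controls; hence `‖(H - E)ψ‖²` and `ε²‖ψ‖²` are both `O(ε)`.

Cauchy–Schwarz for `(H - E)² + ε²` (`norm_inner_sq_le_poisson`) bounds `|u m|² = |⟨δ_m, ψ⟩|²` by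
`O(ε) ∫ dμ / ((x - E)² + ε²)`. So the Poisson integral of `μ` at `E` stays bounded below as `ε → 0`
(`exists_poisson_lower_bound`), whereas it would become arbitrarily small if `μ` had zero derivative
at `E` (`exists_poisson_lt_of_tendsto_zero`).

Almost everywhere the derivative of `μ` is its absolutely continuous density, and for almost every
`E` outside an essential support the densities at all sites vanish. Hence almost no point of `S`
lies outside. An essential support exists because the `δ_n` are countable and span a dense subspace
(`isACEssentialSupport_of_total`). -/

open Set Filter Topology

/-! ### Spectral measures and a Cauchy–Schwarz bound -/

section SpectralMeasure

variable {K : Type*} [NormedAddCommGroup K] [InnerProductSpace ℂ K] [CompleteSpace K]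

instance spectralMeasure_regular (H : K →L[ℂ] K) (φ : K) : (spectralMeasure H φ).Regular := by
  unfold spectralMeasure
  infer_instance

theorem spectralMeasure_univ_le (H : K →L[ℂ] K) (φ : K) :
    spectralMeasure H φ univ ≤ ENNReal.ofReal (‖φ‖ ^ 2) := by
  rw [isOpen_univ.measure_eq_iSup_isCompact]
  refine iSup₂_le fun k _ => iSup_le fun hk => ?_
  obtain ⟨f, hf1, -, hfc, hf⟩ :=
    exists_continuous_one_zero_of_isCompact hk isClosed_empty (disjoint_empty k)
  let g : CompactlySupportedContinuousMap ℝ ℝ := ⟨f, hfc⟩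
  refine (RealRMK.rieszMeasure_le_of_eq_one (spectralFunctional H φ) (f := g)
    (fun x => (hf x).1) hk (fun x hx => hf1 hx)).trans (ENNReal.ofReal_le_ofReal ?_)
  change (inner ℂ φ (cfc (fun x : ℝ => g x) H φ)).re ≤ _
  have hn : ‖cfc (fun x : ℝ => g x) H‖ ≤ 1 := by
    refine norm_cfc_le zero_le_one fun x _ => ?_
    change ‖f x‖ ≤ 1
    rw [Real.norm_eq_abs, abs_of_nonneg (hf x).1]
    exact (hf x).2
  calc (inner ℂ φ (cfc (fun x : ℝ => g x) H φ)).re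
      ≤ ‖inner ℂ φ (cfc (fun x : ℝ => g x) H φ)‖ := Complex.re_le_norm _
    _ ≤ ‖φ‖ * ‖cfc (fun x : ℝ => g x) H φ‖ := norm_inner_le_norm _ _
    _ ≤ ‖φ‖ * (1 * ‖φ‖) := by
        gcongr
        exact ContinuousLinearMap.le_of_opNorm_le _ hn φ
    _ = ‖φ‖ ^ 2 := by ring

instance spectralMeasure_isFinite (H : K →L[ℂ] K) (φ : K) :
    IsFiniteMeasure (spectralMeasure H φ) :=
  ⟨(spectralMeasure_univ_le H φ).trans_lt ENNReal.ofReal_lt_top⟩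

/-- For each `f`, `φ ↦ ⟨φ, f(H) φ⟩` is a quadratic form. The parallelogram law involves positive
measures only, and dropping one term gives `spectralMeasure_add_le` with no complex cross measures.
-/
theorem spectralMeasure_parallelogram (H : K →L[ℂ] K) (φ ψ : K) :
    spectralMeasure H (φ + ψ) + spectralMeasure H (φ - ψ) =
      (spectralMeasure H φ + spectralMeasure H φ) +
        (spectralMeasure H ψ + spectralMeasure H ψ) := by
  refine Measure.ext_of_integral_eq_on_compactlySupported fun f => ?_
  have hint : ∀ χ, Integrable f (spectralMeasure H χ) := fun χ =>
    f.continuous.integrable_of_hasCompactSupport f.hasCompactSupport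
  rw [integral_add_measure (hint _) (hint _),
    integral_add_measure ((hint _).add_measure (hint _)) ((hint _).add_measure (hint _)),
    integral_add_measure (hint _) (hint _), integral_add_measure (hint _) (hint _)]
  simp only [integral_spectralMeasure, map_add, map_sub, inner_add_left, inner_add_right,
    inner_sub_left, inner_sub_right, Complex.add_re, Complex.sub_re]
  ring

theorem spectralMeasure_smul (H : K →L[ℂ] K) (c : ℂ) (φ : K) :
    spectralMeasure H (c • φ) = ENNReal.ofReal (‖c‖ ^ 2) • spectralMeasure H φ := by
  have : (ENNReal.ofReal (‖c‖ ^ 2) • spectralMeasure H φ).Regular :=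
    Measure.Regular.smul ENNReal.ofReal_ne_top
  refine Measure.ext_of_integral_eq_on_compactlySupported fun f => ?_
  rw [integral_smul_measure, integral_spectralMeasure, integral_spectralMeasure,
    ENNReal.toReal_ofReal (by positivity), map_smul, inner_smul_left, inner_smul_right,
    ← mul_assoc, mul_comm ((starRingEnd ℂ) c), Complex.mul_conj, Complex.normSq_eq_norm_sq,
    Complex.re_ofReal_mul, smul_eq_mul]

theorem spectralMeasure_add_le (H : K →L[ℂ] K) (φ ψ : K) (B : Set ℝ) :
    spectralMeasure H (φ + ψ) B ≤
      (spectralMeasure H φ B + spectralMeasure H φ B) +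
        (spectralMeasure H ψ B + spectralMeasure H ψ B) := by
  have h := congrArg (fun μ : Measure ℝ => μ B) (spectralMeasure_parallelogram H φ ψ)
  simp only [Measure.add_apply] at h
  rw [← h]
  exact le_self_add

/-- The vectors whose spectral measure does not charge `B`. -/
noncomputable def spectralNull (H : K →L[ℂ] K) (B : Set ℝ) : Submodule ℂ K where
  carrier := {φ | spectralMeasure H φ B = 0}
  zero_mem' := by
    have h := spectralMeasure_univ_le H (0 : K)
    rw [norm_zero, zero_pow two_ne_zero, ENNReal.ofReal_zero] at h
    exact measure_mono_null (subset_univ B) (le_zero_iff.1 h)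
  add_mem' := by
    intro φ ψ hφ hψ
    have h := spectralMeasure_add_le H φ ψ B
    rw [show spectralMeasure H φ B = 0 from hφ, show spectralMeasure H ψ B = 0 from hψ] at h
    simpa using h
  smul_mem' := by
    intro c φ hφ
    have hφ' : spectralMeasure H φ B = 0 := hφ
    simp [spectralMeasure_smul, hφ']

theorem isClosed_spectralNull (H : K →L[ℂ] K) (B : Set ℝ) :
    IsClosed (spectralNull H B : Set K) := by
  refine isClosed_of_closure_subset fun φ hφ => ?_
  change spectralMeasure H φ B = 0
  obtain ⟨x, hx, hlim⟩ := mem_closure_iff_seq_limit.1 hφ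
  have hle : ∀ n, spectralMeasure H φ B ≤
      ENNReal.ofReal (‖φ - x n‖ ^ 2) + ENNReal.ofReal (‖φ - x n‖ ^ 2) := fun n => by
    have h := spectralMeasure_add_le H (x n) (φ - x n) B
    rw [add_sub_cancel, show spectralMeasure H (x n) B = 0 from hx n, add_zero, zero_add] at h
    have h2 := (measure_mono (subset_univ B)).trans (spectralMeasure_univ_le H (φ - x n))
    exact h.trans (add_le_add h2 h2)
  have ht : Tendsto (fun n => ENNReal.ofReal (‖φ - x n‖ ^ 2) + ENNReal.ofReal (‖φ - x n‖ ^ 2))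
      atTop (𝓝 0) := by
    have h1 : Tendsto (fun n => ‖φ - x n‖ ^ 2) atTop (𝓝 0) := by
      simpa using ((tendsto_const_nhds (x := φ)).sub hlim).norm.pow 2
    have h2 := ENNReal.tendsto_ofReal h1
    simpa using h2.add h2
  exact le_zero_iff.1 (ge_of_tendsto' ht hle)

/-- A cutoff equal to `1` on the compact spectrum leaves `h(H)` unchanged and can only decrease the
integral. This inequality extends the Riesz formula far enough to reach the Poisson kernel, which
lacks compact support. -/
theorem inner_cfc_le_integral (H : K →L[ℂ] K) (φ : K) {h : ℝ → ℝ} (hc : Continuous h)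
    (h0 : ∀ x, 0 ≤ h x) (hint : Integrable h (spectralMeasure H φ)) :
    (inner ℂ φ (cfc h H φ)).re ≤ ∫ x, h x ∂(spectralMeasure H φ) := by
  obtain ⟨f, hf1, -, hfc, hf⟩ := exists_continuous_one_zero_of_isCompact
    (ContinuousFunctionalCalculus.isCompact_spectrum (R := ℝ) H) isClosed_empty (disjoint_empty _)
  have hfc' : HasCompactSupport fun x => f x * h x := HasCompactSupport.mul_right hfc
  let g : CompactlySupportedContinuousMap ℝ ℝ :=
    ⟨⟨fun x => f x * h x, f.continuous.mul hc⟩, hfc'⟩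
  have hgx : ∀ x, g x = f x * h x := fun _ => rfl
  have hg : cfc (fun x : ℝ => g x) H = cfc h H := by
    refine cfc_congr fun x hx => ?_
    have h1 : f x = 1 := hf1 hx
    simp only [hgx, h1, one_mul]
  rw [← hg, ← integral_spectralMeasure]
  refine integral_mono (g.continuous.integrable_of_hasCompactSupport g.hasCompactSupport)
    hint fun x => ?_
  change g x ≤ h x
  rw [hgx]
  exact mul_le_of_le_one_left (h0 x) (hf x).2

/-- Cauchy–Schwarz in the form of `((H - E)² + ε²)⁻¹`. -/
theorem norm_inner_sq_le_poisson {H : K →L[ℂ] K} (hH : IsSelfAdjoint H) (φ ψ : K) (E : ℝ)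
    {ε : ℝ} (hε : 0 < ε) :
    ‖inner ℂ φ ψ‖ ^ 2 ≤ (∫ x, 1 / ((x - E) ^ 2 + ε ^ 2) ∂(spectralMeasure H φ)) *
      (‖H ψ - (E : ℂ) • ψ‖ ^ 2 + ε ^ 2 * ‖ψ‖ ^ 2) := by
  have hpos : ∀ x : ℝ, 0 < (x - E) ^ 2 + ε ^ 2 := fun x => by positivity
  have hcR : Continuous fun x : ℝ => 1 / ((x - E) ^ 2 + ε ^ 2) :=
    continuous_const.div (by fun_prop) fun x => (hpos x).ne'
  have hcQ : Continuous fun x : ℝ => √(1 / ((x - E) ^ 2 + ε ^ 2)) := hcR.sqrt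
  set Q : K →L[ℂ] K := cfc (fun x : ℝ => √(1 / ((x - E) ^ 2 + ε ^ 2))) H with hQ
  set R : K →L[ℂ] K := cfc (fun x : ℝ => 1 / ((x - E) ^ 2 + ε ^ 2)) H with hR
  set D : K →L[ℂ] K := H - (E : ℂ) • (1 : K →L[ℂ] K) with hD
  set T : K →L[ℂ] K := D * D + ((ε ^ 2 : ℝ) : ℂ) • (1 : K →L[ℂ] K) with hT
  have hQQ : Q * Q = R := by
    rw [hQ, hR, ← cfc_mul _ _ H hcQ.continuousOn hcQ.continuousOn]
    refine cfc_congr fun x _ => Real.mul_self_sqrt (by have := hpos x; positivity)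
  have hDcfc : D = cfc (fun x : ℝ => x - E) H := by
    rw [cfc_sub (fun x : ℝ => x) (fun _ => E) H (by fun_prop) (by fun_prop), cfc_id' ℝ H, cfc_const E H, hD,
      Algebra.algebraMap_eq_smul_one]
    congr 1
  have hTcfc : T = cfc (fun x : ℝ => (x - E) ^ 2 + ε ^ 2) H := by
    rw [cfc_add H (fun x : ℝ => (x - E) ^ 2) (fun _ => ε ^ 2) (by fun_prop) (by fun_prop),
      cfc_pow (fun x : ℝ => x - E) 2 H (by fun_prop), ← hDcfc,
      cfc_const _ H, hT, Algebra.algebraMap_eq_smul_one, pow_two D]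
    congr 1
  have hRT : R * T = 1 := by
    rw [hTcfc, hR, ← cfc_mul _ _ H hcR.continuousOn (by fun_prop), ← cfc_one ℝ H]
    exact cfc_congr fun x _ => one_div_mul_cancel (hpos x).ne'
  have hQsa : IsSelfAdjoint Q := cfc_predicate _ H
  have hDsa : IsSelfAdjoint D := hDcfc ▸ cfc_predicate _ H
  have hsymm : ∀ {A : K →L[ℂ] K}, IsSelfAdjoint A → ∀ x y, inner ℂ (A x) y = inner ℂ x (A y) :=
    fun hA x y => hA.isSymmetric x y
  have hRTψ : R (T ψ) = ψ := congrArg (fun A : K →L[ℂ] K => A ψ) hRT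
  have hQQa : ∀ x, Q (Q x) = R x := fun x => congrArg (fun A : K →L[ℂ] K => A x) hQQ
  -- `Q = T^(-1/2)` with `T = (H - E)² + ε²`: Cauchy–Schwarz is applied after splitting `T⁻¹T = 1`
  -- as `Q · QT`.
  have h1 : inner ℂ φ ψ = inner ℂ (Q φ) (Q (T ψ)) := by
    rw [hsymm hQsa, hQQa, hRTψ]
  have h2 : ‖Q φ‖ ^ 2 = (inner ℂ φ (R φ)).re := by
    rw [← hQQa, ← hsymm hQsa, inner_self_eq_norm_sq_to_K]
    norm_cast
  have h3 : ‖Q (T ψ)‖ ^ 2 = ‖D ψ‖ ^ 2 + ε ^ 2 * ‖ψ‖ ^ 2 := by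
    have e1 : inner ℂ (Q (T ψ)) (Q (T ψ)) = inner ℂ (T ψ) ψ := by
      rw [hsymm hQsa, hQQa, hRTψ]
    have e2 : T ψ = D (D ψ) + ((ε ^ 2 : ℝ) : ℂ) • ψ := rfl
    rw [e2, inner_add_left, hsymm hDsa, inner_smul_left, inner_self_eq_norm_sq_to_K,
      inner_self_eq_norm_sq_to_K, inner_self_eq_norm_sq_to_K, Complex.conj_ofReal, ← e2] at e1
    have e3 := congrArg Complex.re e1
    simpa [← Complex.ofReal_pow] using e3
  have h4 : (inner ℂ φ (R φ)).re ≤ ∫ x, 1 / ((x - E) ^ 2 + ε ^ 2) ∂(spectralMeasure H φ) := by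
    refine inner_cfc_le_integral H φ hcR (fun x => by have := hpos x; positivity) ?_
    refine Integrable.of_bound hcR.aestronglyMeasurable (1 / ε ^ 2) (Eventually.of_forall ?_)
    intro x
    rw [Real.norm_eq_abs, abs_of_nonneg (by have := hpos x; positivity)]
    exact one_div_le_one_div_of_le (by positivity) (by nlinarith [sq_nonneg (x - E)])
  have h5 : D ψ = H ψ - (E : ℂ) • ψ := rfl
  calc ‖inner ℂ φ ψ‖ ^ 2 ≤ (‖Q φ‖ * ‖Q (T ψ)‖) ^ 2 := by
        rw [h1]; gcongr; exact norm_inner_le_norm _ _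
    _ = (inner ℂ φ (R φ)).re * (‖D ψ‖ ^ 2 + ε ^ 2 * ‖ψ‖ ^ 2) := by rw [mul_pow, h2, h3]
    _ ≤ _ := by rw [h5]; gcongr

end SpectralMeasure

/-! ### Poisson integrals and derivatives of measures -/

theorem lintegral_poisson_le_of_growth {μ : Measure ℝ} {E η ε : ℝ} (hε : 0 < ε) (hη : 0 ≤ η)
    (h : ∀ r > 0, μ (Metric.closedBall E r) ≤ ENNReal.ofReal (η * r)) :
    ∫⁻ x, ENNReal.ofReal (ε / ((x - E) ^ 2 + ε ^ 2)) ∂μ ≤ ENNReal.ofReal (8 * η) := by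
  -- On `2^(j-1) ε < |x - E| ≤ 2^j ε` the kernel is at most `ε / (2^(j-1) ε)² = c j`, and for `j =
  -- 0` it is at most `1/ε ≤ c 0`. Ball masses `η 2^j ε` then give `∑ 4η 2^(-j) = 8η`.
  set c : ℕ → ℝ := fun j => 4 / ε * (1 / 4) ^ j
  set F : ℕ → ℝ → ℝ≥0∞ := fun j =>
    (Metric.closedBall E (2 ^ j * ε)).indicator fun _ => ENNReal.ofReal (c j)
  have hpt : ∀ x, ENNReal.ofReal (ε / ((x - E) ^ 2 + ε ^ 2)) ≤ ∑' j, F j x := by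
    intro x
    have hex : ∃ j : ℕ, |x - E| ≤ 2 ^ j * ε := by
      obtain ⟨j, hj⟩ := pow_unbounded_of_one_lt (|x - E| / ε) (one_lt_two (α := ℝ))
      exact ⟨j, ((div_lt_iff₀ hε).1 hj).le⟩
    classical
    set j := Nat.find hex with hj
    have hjs : |x - E| ≤ 2 ^ j * ε := Nat.find_spec hex
    refine le_trans ?_ (ENNReal.le_tsum j)
    have hmem : x ∈ Metric.closedBall E (2 ^ j * ε) := by
      rwa [Metric.mem_closedBall, Real.dist_eq]
    simp only [F, indicator_of_mem hmem]
    refine ENNReal.ofReal_le_ofReal ?_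
    rcases hj0 : j with _ | i
    · simp only [c, pow_zero, mul_one]
      rw [div_le_div_iff₀ (by positivity) hε]
      nlinarith [sq_nonneg (x - E), sq_nonneg ε]
    · have hlt : 2 ^ i * ε < |x - E| := not_le.1 (Nat.find_min hex (by omega))
      have hsq : (2 ^ i * ε) ^ 2 ≤ (x - E) ^ 2 := by
        rw [← sq_abs (x - E)]
        exact pow_le_pow_left₀ (by positivity) hlt.le 2
      have hc : c (i + 1) = ε / (2 ^ i * ε) ^ 2 := by
        simp only [c]
        rw [pow_succ, mul_pow, ← pow_mul, mul_comm i 2, pow_mul, one_div, inv_pow]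
        norm_num
        field_simp
      rw [hc]
      exact div_le_div_of_nonneg_left hε.le (by positivity) (by nlinarith [sq_nonneg ε])
  have hFm : ∀ j, Measurable (F j) := fun j =>
    measurable_const.indicator Metric.isClosed_closedBall.measurableSet
  calc ∫⁻ x, ENNReal.ofReal (ε / ((x - E) ^ 2 + ε ^ 2)) ∂μ
      ≤ ∫⁻ x, ∑' j, F j x ∂μ := lintegral_mono hpt
    _ = ∑' j, ∫⁻ x, F j x ∂μ := lintegral_tsum fun j => (hFm j).aemeasurable
    _ ≤ ∑' j : ℕ, ENNReal.ofReal (4 * η * (1 / 2) ^ j) := by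
        refine ENNReal.tsum_le_tsum fun j => ?_
        simp only [F]
        rw [lintegral_indicator_const Metric.isClosed_closedBall.measurableSet]
        refine (mul_le_mul_right (h _ (by positivity)) _).trans (le_of_eq ?_)
        rw [← ENNReal.ofReal_mul (by positivity)]
        congr 1
        have h4 : (1 / 4 : ℝ) ^ j * 2 ^ j = (1 / 2) ^ j := by rw [← mul_pow]; norm_num
        rw [← h4]
        simp only [c]
        field_simp
    _ = ENNReal.ofReal (8 * η) := by
        rw [← ENNReal.ofReal_tsum_of_nonneg (fun j => by positivity)
          (summable_geometric_two.mul_left _), tsum_mul_left, tsum_geometric_two]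
        congr 1
        ring

/-- If the derivative of a finite measure at `E` vanishes, so does the boundary limit of its
Poisson integral. -/
theorem exists_poisson_lt_of_tendsto_zero {μ : Measure ℝ} [IsFiniteMeasure μ] {E : ℝ}
    (h : Tendsto (fun r => μ (Metric.closedBall E r) / volume (Metric.closedBall E r))
      (𝓝[>] 0) (𝓝 0)) {c : ℝ} (hc : 0 < c) :
    ∃ ε, 0 < ε ∧ ε < 1 ∧ ε * ∫ x, 1 / ((x - E) ^ 2 + ε ^ 2) ∂μ < c := by
  -- A ball has length `2r`, so the growth constant is `2η` and the part near `E` contributes at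
  -- most `16η = c/2`; the far part will add `c/4`.
  set η : ℝ := c / 32
  have hη : 0 < η := by positivity
  have hev : ∀ᶠ r in 𝓝[>] (0 : ℝ), μ (Metric.closedBall E r) / volume (Metric.closedBall E r)
      < ENNReal.ofReal η := h.eventually_lt_const (by simpa using hη)
  obtain ⟨r₀, hr₀, hsub⟩ := mem_nhdsGT_iff_exists_Ioc_subset.1 hev
  have hr₀' : (0 : ℝ) < r₀ := hr₀
  have hball : ∀ r, 0 < r → r ≤ r₀ →
      μ (Metric.closedBall E r) ≤ ENNReal.ofReal (2 * η * r) := by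
    intro r hr hr2
    have h1 : μ (Metric.closedBall E r) / volume (Metric.closedBall E r) ≤ ENNReal.ofReal η :=
      le_of_lt (hsub ⟨hr, hr2⟩)
    rw [Real.volume_closedBall, ENNReal.div_le_iff (by simpa using hr) ENNReal.ofReal_ne_top,
      ← ENNReal.ofReal_mul hη.le] at h1
    refine h1.trans (le_of_eq ?_)
    congr 1
    ring
  set B := Metric.closedBall E r₀ with hB
  have hBm : MeasurableSet B := Metric.isClosed_closedBall.measurableSet
  -- Restriction to `B` makes the small-radius bound valid at every radius.
  have hgrow : ∀ r > 0, (μ.restrict B) (Metric.closedBall E r) ≤ ENNReal.ofReal (2 * η * r) := by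
    intro r hr
    rcases le_total r r₀ with hle | hle
    · exact (Measure.restrict_apply_le _ _).trans (hball r hr hle)
    · refine (measure_mono (subset_univ _)).trans ?_
      rw [Measure.restrict_apply_univ]
      refine (hball r₀ hr₀' le_rfl).trans (ENNReal.ofReal_le_ofReal (by gcongr))
  set m := μ.real univ with hm
  have hm0 : 0 ≤ m := measureReal_nonneg
  set ε : ℝ := min (1 / 2) (c * r₀ ^ 2 / (4 * (m + 1))) with hεdef
  have hε : 0 < ε := lt_min (by norm_num) (by positivity)
  have hε2 : ε * m / r₀ ^ 2 ≤ c / 4 := by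
    have h1 : ε ≤ c * r₀ ^ 2 / (4 * (m + 1)) := min_le_right _ _
    rw [le_div_iff₀ (by positivity)] at h1
    rw [div_le_iff₀ (by positivity)]
    nlinarith
  refine ⟨ε, hε, (min_le_left _ _).trans_lt (by norm_num), ?_⟩
  have hle : ∫⁻ x, ENNReal.ofReal (ε / ((x - E) ^ 2 + ε ^ 2)) ∂μ ≤ ENNReal.ofReal (c / 2 + c / 4) := by
    rw [← lintegral_add_compl _ hBm, ENNReal.ofReal_add (by positivity) (by positivity)]
    refine add_le_add ((lintegral_poisson_le_of_growth hε (by positivity) hgrow).trans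
      (ENNReal.ofReal_le_ofReal (le_of_eq (by simp only [η]; ring)))) ?_
    calc ∫⁻ x in Bᶜ, ENNReal.ofReal (ε / ((x - E) ^ 2 + ε ^ 2)) ∂μ
        ≤ ∫⁻ _ in Bᶜ, ENNReal.ofReal (ε / r₀ ^ 2) ∂μ := by
          refine setLIntegral_mono measurable_const fun x hx => ENNReal.ofReal_le_ofReal ?_
          have hx' : r₀ < |x - E| := by
            simpa [hB, Metric.mem_closedBall, Real.dist_eq] using hx
          have : r₀ ^ 2 ≤ (x - E) ^ 2 := by
            rw [← sq_abs (x - E)]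
            exact pow_le_pow_left₀ hr₀'.le hx'.le 2
          exact div_le_div_of_nonneg_left hε.le (by positivity) (by nlinarith [sq_nonneg ε])
      _ ≤ ENNReal.ofReal (ε / r₀ ^ 2) * μ univ := by
          rw [setLIntegral_const]
          exact mul_le_mul_right (measure_mono (subset_univ _)) _
      _ = ENNReal.ofReal (ε * m / r₀ ^ 2) := by
          rw [← ofReal_measureReal, ← ENNReal.ofReal_mul (by positivity)]
          congr 1
          ring
      _ ≤ ENNReal.ofReal (c / 4) := ENNReal.ofReal_le_ofReal hε2
  rw [← integral_const_mul]
  simp only [mul_one_div]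
  rw [integral_eq_lintegral_of_nonneg_ae (Eventually.of_forall fun x => by positivity)
    (by
      refine Continuous.aestronglyMeasurable (continuous_const.div (by fun_prop) fun x => ?_)
      positivity)]
  refine lt_of_le_of_lt (ENNReal.toReal_le_of_le_ofReal (by positivity) hle) (by linarith)

/-! ### Cutoffs of generalized eigenfunctions on the lattice -/

section Lattice

theorem shiftTwo_apply (k : ℤ) (f : EllTwo) (n : ℤ) : shiftTwo k f n = f (n + k) := rfl

theorem norm_shiftTwo_apply_le (k : ℤ) (f : EllTwo) : ‖shiftTwo k f‖ ≤ ‖f‖ := by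
  simpa using ContinuousLinearMap.le_of_opNorm_le _ (shiftTwo_norm_le k) f

theorem shiftTwo_shiftTwo (k l : ℤ) (f : EllTwo) :
    shiftTwo k (shiftTwo l f) = shiftTwo (k + l) f := by
  ext n
  simp only [shiftTwo_apply, add_assoc]

theorem shiftTwo_zero (f : EllTwo) : shiftTwo 0 f = f := by
  ext n
  simp only [shiftTwo_apply, add_zero]

theorem norm_shiftTwo_natCast_sub_le (k : ℕ) (f : EllTwo) :
    ‖shiftTwo k f - f‖ ≤ k * ‖shiftTwo 1 f - f‖ := by
  induction k with
  | zero => simp [shiftTwo_zero]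
  | succ k ih =>
    have h : shiftTwo ((k + 1 : ℕ) : ℤ) f - f =
        shiftTwo k (shiftTwo 1 f - f) + (shiftTwo k f - f) := by
      rw [map_sub, shiftTwo_shiftTwo]
      push_cast
      abel
    rw [h]
    refine (norm_add_le _ _).trans ((add_le_add (norm_shiftTwo_apply_le _ _) ih).trans ?_)
    push_cast
    linarith

/-- Telescoping into unit shifts, each a contraction. The factor `|k|` is what calls for the first
moment of `w`. -/
theorem norm_shiftTwo_sub_le (k : ℤ) (f : EllTwo) :
    ‖shiftTwo k f - f‖ ≤ |(k : ℝ)| * ‖shiftTwo 1 f - f‖ := by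
  obtain ⟨n, rfl | rfl⟩ := k.eq_nat_or_neg
  · simpa using norm_shiftTwo_natCast_sub_le n f
  · have h : shiftTwo (-n) f - f = -shiftTwo (-n) (shiftTwo n f - f) := by
      rw [map_sub, shiftTwo_shiftTwo, neg_add_cancel, shiftTwo_zero, neg_sub]
    rw [h, norm_neg]
    refine (norm_shiftTwo_apply_le _ _).trans ?_
    simpa using norm_shiftTwo_natCast_sub_le n f

/-- The product of a bounded sequence and an element of `ℓ²(ℤ)`. -/
noncomputable def boundedMul {u : ℤ → ℂ} {M : ℝ} (hu : ∀ n, ‖u n‖ ≤ M) (f : EllTwo) : EllTwo :=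
  ⟨fun n => u n * f n, (lp.memℓp ((M : ℂ) • f)).mono' fun n => by
    rw [lp.coeFn_smul, Pi.smul_apply, norm_smul, norm_mul, Complex.norm_real]
    exact mul_le_mul_of_nonneg_right ((hu n).trans (le_abs_self _)) (norm_nonneg _)⟩

theorem boundedMul_apply {u : ℤ → ℂ} {M : ℝ} (hu : ∀ n, ‖u n‖ ≤ M) (f : EllTwo) (n : ℤ) :
    boundedMul hu f n = u n * f n := rfl

theorem norm_boundedMul_le {u : ℤ → ℂ} {M : ℝ} (hu : ∀ n, ‖u n‖ ≤ M) (f : EllTwo) :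
    ‖boundedMul hu f‖ ≤ M * ‖f‖ := by
  have hM : 0 ≤ M := (norm_nonneg _).trans (hu 0)
  refine (lp.norm_mono (p := 2) (by norm_num) (y := (M : ℂ) • f) fun n => ?_).trans (le_of_eq ?_)
  · rw [lp.coeFn_smul, Pi.smul_apply, norm_smul, boundedMul_apply, norm_mul, Complex.norm_real]
    exact mul_le_mul_of_nonneg_right ((hu n).trans (le_abs_self _)) (norm_nonneg _)
  · rw [norm_smul, Complex.norm_real, Real.norm_of_nonneg hM]

theorem CubicDecay.summable_mul_abs {w : ℤ → ℂ} (hw : CubicDecay w) :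
    Summable fun k : ℤ => ‖w k‖ * |(k : ℝ)| := by
  obtain ⟨C, hC⟩ := hw
  have h1 : Summable fun k : ℤ => |(k : ℝ)| ^ (-2 : ℝ) :=
    Real.summable_abs_int_rpow (by norm_num)
  refine Summable.of_nonneg_of_le (fun k => by positivity) (fun k => ?_) (h1.mul_left |C|)
  rcases eq_or_ne k 0 with rfl | hk
  · simp
  have hk' : 0 < |(k : ℝ)| := abs_pos.2 (by exact_mod_cast hk)
  have h2 : ‖w k‖ ≤ |C| / |(k : ℝ)| ^ 3 :=
    (hC k hk).le.trans (div_le_div_of_nonneg_right (le_abs_self C) (by positivity))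
  rw [Real.rpow_neg (abs_nonneg _), show (2 : ℝ) = ((2 : ℕ) : ℝ) by norm_num, Real.rpow_natCast]
  calc ‖w k‖ * |(k : ℝ)| ≤ |C| / |(k : ℝ)| ^ 3 * |(k : ℝ)| := by gcongr
    _ = |C| * (|(k : ℝ)| ^ 2)⁻¹ := by field_simp

/-- A cutoff of a bounded generalized eigenfunction is an approximate eigenvector, with an error
controlled by the variation of the cutoff. -/
theorem norm_longRangeOperator_boundedMul_sub_le {w : ℤ → ℂ} {v : ℤ → ℝ} (hw : CubicDecay w)
    (hv : ∃ M : ℝ, ∀ n, |v n| ≤ M) {E : ℝ} {u : ℤ → ℂ} {M : ℝ} (hu : ∀ n, ‖u n‖ ≤ M)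
    (heig : ∀ n, longRangeAction w v u n = (E : ℂ) * u n) (f : EllTwo) :
    ‖longRangeOperator w v hv (boundedMul hu f) - (E : ℂ) • boundedMul hu f‖ ≤
      M * (∑' k : ℤ, ‖w k‖ * |(k : ℝ)|) * ‖shiftTwo 1 f - f‖ := by
  have hM : 0 ≤ M := (norm_nonneg _).trans (hu 0)
  let d : ℤ → EllTwo := fun k => boundedMul (fun n => hu (n + k)) (shiftTwo k f - f)
  have hb : ∀ k, ‖w k • d k‖ ≤ M * ‖shiftTwo 1 f - f‖ * (‖w k‖ * |(k : ℝ)|) := by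
    intro k
    rw [norm_smul]
    have h1 : ‖d k‖ ≤ M * (|(k : ℝ)| * ‖shiftTwo 1 f - f‖) :=
      (norm_boundedMul_le _ _).trans (by gcongr; exact norm_shiftTwo_sub_le k f)
    calc ‖w k‖ * ‖d k‖ ≤ ‖w k‖ * (M * (|(k : ℝ)| * ‖shiftTwo 1 f - f‖)) := by gcongr
      _ = _ := by ring
  have hsum := hw.summable_mul_abs.hasSum.mul_left (M * ‖shiftTwo 1 f - f‖)
  have hds : Summable fun k => w k • d k := Summable.of_norm_bounded hsum.summable hb
  -- Subtracting `f n` times the eigenvalue equation removes `v` and `E`, leaving `∑ w_k u_{n+k}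
  -- (f_{n+k} - f_n)`.
  have key : longRangeOperator w v hv (boundedMul hu f) - (E : ℂ) • boundedMul hu f =
      ∑' k, w k • d k := by
    ext n
    have h1 := hds.hasSum.mapL (lp.evalCLM ℂ (fun _ : ℤ => ℂ) 2 n)
    have h2 : (∑' k, w k • d k : EllTwo) n = ∑' k, w k * (u (n + k) * (f (n + k) - f n)) :=
      h1.tsum_eq.symm
    have hs1 : Summable fun k => w k * u (n + k) := by
      refine Summable.of_norm_bounded (hw.summable.mul_right M) fun k => ?_
      rw [norm_mul]
      gcongr
      exact hu _
    have hs2 : Summable fun k => w k * (u (n + k) * f (n + k)) := by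
      refine Summable.of_norm_bounded (hw.summable.mul_right (M * ‖f‖)) fun k => ?_
      rw [norm_mul, norm_mul]
      gcongr
      · exact hu _
      · exact lp.norm_apply_le_norm two_ne_zero f _
    have h3 : ∑' k, w k * (u (n + k) * (f (n + k) - f n)) =
        ∑' k, w k * (u (n + k) * f (n + k)) - (∑' k, w k * u (n + k)) * f n := by
      rw [← tsum_mul_right, ← hs2.tsum_sub (hs1.mul_right _)]
      exact tsum_congr fun k => by ring
    have h4 := heig n
    rw [longRangeAction] at h4
    rw [h2, h3, lp.coeFn_sub, Pi.sub_apply, longRangeOperator_apply hw, lp.coeFn_smul,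
      Pi.smul_apply, smul_eq_mul, longRangeAction]
    simp only [boundedMul_apply]
    linear_combination f n * h4
  rw [key]
  refine (tsum_of_norm_bounded hsum hb).trans (le_of_eq (by ring))

theorem hasSum_pow_natAbs {q : ℝ} (h0 : 0 ≤ q) (h1 : q < 1) :
    HasSum (fun n : ℤ => q ^ n.natAbs) ((1 - q)⁻¹ + q * (1 - q)⁻¹) := by
  have h := hasSum_geometric_of_lt_one h0 h1
  refine HasSum.of_nat_of_neg_add_one (by simpa using h) ?_
  have h2 := h.mul_left q
  refine h2.congr_fun fun n => ?_
  have : (-((n : ℤ) + 1)).natAbs = n + 1 := by omega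
  rw [this, pow_succ']

/-- A cutoff of width `1 / ε`, namely `n ↦ (1 - ε)^|n|`. -/
theorem exists_exponential_cutoff {ε : ℝ} (h0 : 0 < ε) (h1 : ε < 1) :
    ∃ f : EllTwo, f 0 = 1 ∧ ‖f‖ ^ 2 ≤ 2 / ε ∧ ‖shiftTwo 1 f - f‖ ≤ 2 * ε * ‖f‖ := by
  set q : ℝ := 1 - ε with hq
  have hq0 : 0 < q := by linarith
  have hq1 : q < 1 := by linarith
  have hs := hasSum_pow_natAbs (q := q ^ 2) (by positivity) (by nlinarith)
  have hn : ∀ n : ℤ, ‖((q ^ n.natAbs : ℝ) : ℂ)‖ ^ (2 : ℝ≥0∞).toReal = (q ^ 2) ^ n.natAbs := by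
    intro n
    rw [Complex.norm_real, Real.norm_of_nonneg (by positivity), ENNReal.toReal_ofNat,
      Real.rpow_ofNat, ← pow_mul, ← pow_mul, mul_comm]
  let f : EllTwo := ⟨fun n => ((q ^ n.natAbs : ℝ) : ℂ), memℓp_gen (by
    simp only [hn]; exact hs.summable)⟩
  have hf : ∀ n, f n = ((q ^ n.natAbs : ℝ) : ℂ) := fun _ => rfl
  refine ⟨f, by simp [hf], ?_, ?_⟩
  · have h := lp.norm_rpow_eq_tsum (p := 2) (by norm_num) f
    simp only [hf, hn, hs.tsum_eq] at h
    rw [ENNReal.toReal_ofNat, Real.rpow_ofNat] at h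
    rw [h]
    have h2 : 1 - q ^ 2 = ε * (1 + q) := by rw [hq]; ring
    have h3 : (1 - q ^ 2)⁻¹ + q ^ 2 * (1 - q ^ 2)⁻¹ = (1 + q ^ 2) / (1 + q) / ε := by
      rw [h2]
      field_simp
    rw [h3]
    refine div_le_div_of_nonneg_right ?_ h0.le
    rw [div_le_iff₀ (by positivity)]
    nlinarith
  -- Neighbouring values differ by a factor `q = 1 - ε`, so their difference is `ε` times the larger
  -- one; the sum dominates whichever is larger.
  · have h2 : ‖shiftTwo 1 f - f‖ ≤ ‖(ε : ℂ) • (shiftTwo 1 f + f)‖ := by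
      refine lp.norm_mono (p := 2) (by norm_num) fun n => ?_
      have e1 : (shiftTwo 1 f - f) n = ((q ^ (n + 1).natAbs - q ^ n.natAbs : ℝ) : ℂ) := by
        rw [lp.coeFn_sub, Pi.sub_apply, shiftTwo_apply, hf, hf, Complex.ofReal_sub]
      have e2 : ((ε : ℂ) • (shiftTwo 1 f + f)) n =
          ((ε * (q ^ (n + 1).natAbs + q ^ n.natAbs) : ℝ) : ℂ) := by
        rw [lp.coeFn_smul, Pi.smul_apply, lp.coeFn_add, Pi.add_apply, shiftTwo_apply, hf, hf]
        push_cast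
        rfl
      rw [e1, e2, Complex.norm_real, Complex.norm_real, Real.norm_eq_abs, Real.norm_eq_abs,
        abs_of_nonneg (by positivity : 0 ≤ ε * (q ^ (n + 1).natAbs + q ^ n.natAbs)), abs_le]
      have hp : ∀ j : ℕ, 0 < q ^ j := fun j => pow_pos hq0 j
      rcases (by omega : (n + 1).natAbs = n.natAbs + 1 ∨ n.natAbs = (n + 1).natAbs + 1) with h | h
      · rw [h, pow_succ]
        have := hp n.natAbs
        constructor <;> nlinarith [mul_pos this h0, mul_pos (mul_pos this hq0) h0]
      · rw [h, pow_succ]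
        have := hp (n + 1).natAbs
        constructor <;> nlinarith [mul_pos this h0, mul_pos (mul_pos this hq0) h0]
    refine h2.trans ?_
    rw [norm_smul, Complex.norm_real, Real.norm_of_nonneg h0.le]
    have h3 : ‖shiftTwo 1 f + f‖ ≤ ‖f‖ + ‖f‖ :=
      (norm_add_le _ _).trans (add_le_add_left (norm_shiftTwo_apply_le 1 f) _)
    nlinarith

/-- The Poisson integral of the spectral measure at a site where a bounded generalized
eigenfunction does not vanish is bounded below near the real axis. -/
theorem exists_poisson_lower_bound {w : ℤ → ℂ} {v : ℤ → ℝ} (hsymm : ∀ k, star (w (-k)) = w k)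
    (hw : CubicDecay w) (hv : ∃ M : ℝ, ∀ n, |v n| ≤ M) {E : ℝ} {u : ℤ → ℂ}
    (hu : IsBoundedSolution w v E u) {m : ℤ} (hm : u m ≠ 0) :
    ∃ c > 0, ∀ ε, 0 < ε → ε < 1 → c ≤ ε * ∫ x, 1 / ((x - E) ^ 2 + ε ^ 2)
      ∂(spectralMeasure (longRangeOperator w v hv) (lp.single 2 m (1 : ℂ))) := by
  obtain ⟨M, hM⟩ := hu.bounded
  have hM0 : 0 < M := (norm_pos_iff.2 hm).trans_le (hM m)
  set W := ∑' k : ℤ, ‖w k‖ * |(k : ℝ)| with hW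
  have hW0 : 0 ≤ W := tsum_nonneg fun k => by positivity
  -- With `ε‖f‖² ≤ 2`, the squared commutator bound `(MW · 2ε‖f‖)²` gives the first term and
  -- `ε²(M‖f‖)²` the second, each times `ε`.
  set D := 8 * (M * W) ^ 2 + 2 * M ^ 2 with hD
  have hD0 : 0 < D := by positivity
  refine ⟨‖u m‖ ^ 2 / D, div_pos (pow_pos (norm_pos_iff.2 hm) 2) hD0, fun ε h0 h1 => ?_⟩
  obtain ⟨f, hf0, hfn, hfs⟩ := exists_exponential_cutoff h0 h1
  set g := shiftTwo (-m) f with hg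
  have hgm : g m = 1 := by rw [hg, shiftTwo_apply, add_neg_cancel, hf0]
  have hgn : ‖g‖ ≤ ‖f‖ := norm_shiftTwo_apply_le _ _
  have hgs : ‖shiftTwo 1 g - g‖ ≤ 2 * ε * ‖f‖ := by
    have : shiftTwo 1 g - g = shiftTwo (-m) (shiftTwo 1 f - f) := by
      rw [hg, map_sub, shiftTwo_shiftTwo, shiftTwo_shiftTwo, add_comm]
    rw [this]
    exact (norm_shiftTwo_apply_le _ _).trans hfs
  set I := ∫ x, 1 / ((x - E) ^ 2 + ε ^ 2)
      ∂(spectralMeasure (longRangeOperator w v hv) (lp.single 2 m (1 : ℂ))) with hI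
  have hI0 : 0 ≤ I := integral_nonneg fun x => by positivity
  have hmain := norm_inner_sq_le_poisson (longRangeOperator_isSelfAdjoint hsymm v hv)
    (lp.single 2 m (1 : ℂ)) (boundedMul hM g) E h0
  rw [lp.inner_single_left, boundedMul_apply, hgm, mul_one, ← hI] at hmain
  have h2 : ‖inner ℂ (1 : ℂ) (u m)‖ = ‖u m‖ := by simp
  rw [h2] at hmain
  have hf2 : ε * ‖f‖ ^ 2 ≤ 2 := by
    rw [le_div_iff₀ h0] at hfn
    linarith
  have h3 : ‖longRangeOperator w v hv (boundedMul hM g) - (E : ℂ) • boundedMul hM g‖ ^ 2 ≤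
      8 * (M * W) ^ 2 * ε := by
    have h := (norm_longRangeOperator_boundedMul_sub_le hw hv hM hu.eigen g).trans
      (mul_le_mul_of_nonneg_left hgs (by positivity))
    calc _ ≤ (M * W * (2 * ε * ‖f‖)) ^ 2 := pow_le_pow_left₀ (norm_nonneg _) h 2
      _ = 4 * (M * W) ^ 2 * ε * (ε * ‖f‖ ^ 2) := by ring
      _ ≤ 4 * (M * W) ^ 2 * ε * 2 := by gcongr
      _ = _ := by ring
  have h4 : ε ^ 2 * ‖boundedMul hM g‖ ^ 2 ≤ 2 * M ^ 2 * ε := by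
    have h : ‖boundedMul hM g‖ ≤ M * ‖f‖ := (norm_boundedMul_le _ _).trans (by gcongr)
    calc _ ≤ ε ^ 2 * (M * ‖f‖) ^ 2 := by gcongr
      _ = M ^ 2 * ε * (ε * ‖f‖ ^ 2) := by ring
      _ ≤ M ^ 2 * ε * 2 := by gcongr
      _ = _ := by ring
  rw [div_le_iff₀ hD0]
  calc ‖u m‖ ^ 2 ≤ I * (8 * (M * W) ^ 2 * ε + 2 * M ^ 2 * ε) :=
        hmain.trans (by gcongr)
    _ = ε * I * D := by rw [hD]; ring

theorem mem_of_isClosed_of_single_mem {V : Submodule ℂ EllTwo}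
    (hV : IsClosed (V : Set EllTwo)) (h : ∀ n : ℤ, lp.single 2 n (1 : ℂ) ∈ V) (f : EllTwo) :
    f ∈ V := by
  have hf := lp.hasSum_single (p := 2) (by norm_num) f
  refine hV.mem_of_tendsto hf (Eventually.of_forall fun s => V.sum_mem fun n _ => ?_)
  have : lp.single 2 n (f n) = f n • (lp.single 2 n (1 : ℂ) : EllTwo) := by
    rw [← lp.single_smul, smul_eq_mul, mul_one]
  rw [this]
  exact V.smul_mem _ (h n)

end Lattice

/-! ### Essential supports of the absolutely continuous spectrum -/

section EssentialSupport

variable {K : Type*} [NormedAddCommGroup K] [InnerProductSpace ℂ K] [CompleteSpace K]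

theorem CarriesAC.ae_rnDeriv_eq_zero {H : K →L[ℂ] K} {T : Set ℝ} (hT : CarriesAC H T) (φ : K) :
    ∀ᵐ x, x ∉ T → (spectralMeasure H φ).rnDeriv volume x = 0 := by
  have h := hT.2 φ
  rw [acSpectralMeasure, withDensity_apply_eq_zero (Measure.measurable_rnDeriv _ _)] at h
  filter_upwards [measure_eq_zero_iff_ae_notMem.1 h] with x hx hxT
  by_contra hne
  exact hx ⟨hne, hxT⟩

theorem isACEssentialSupport_of_total {ι : Type*} [Countable ι] (H : K →L[ℂ] K) (e : ι → K)
    (he : ∀ V : Submodule ℂ K, IsClosed (V : Set K) → (∀ i, e i ∈ V) → ∀ φ, φ ∈ V) :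
    IsACEssentialSupport H {x | ∃ i, (spectralMeasure H (e i)).rnDeriv volume x ≠ 0} := by
  set A := {x | ∃ i, (spectralMeasure H (e i)).rnDeriv volume x ≠ 0} with hA
  have hAm : MeasurableSet A := by
    rw [hA, ofPred_exists]
    exact MeasurableSet.iUnion fun i =>
      (Measure.measurable_rnDeriv _ _ (measurableSet_singleton 0)).compl
  refine ⟨⟨hAm, fun φ => ?_⟩, fun T hT => ?_⟩
  · choose s hsm hs1 hs2 using fun i =>
      Measure.mutuallySingular_singularPart (spectralMeasure H (e i)) volume
    -- The Lebesgue-null set `N` carries every singular part. So all `μ_{e i}` vanish on `Aᶜ \ N`,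
    -- and closedness of `spectralNull` passes this to every `φ`.
    set N := ⋃ i, (s i)ᶜ with hN
    have hN0 : volume N = 0 := measure_iUnion_null hs2
    have hB : ∀ i, spectralMeasure H (e i) (Aᶜ \ N) = 0 := by
      intro i
      rw [(spectralMeasure H (e i)).haveLebesgueDecomposition_add volume, Measure.add_apply]
      have h1 : (spectralMeasure H (e i)).singularPart volume (Aᶜ \ N) = 0 := by
        refine measure_mono_null (fun x hx => ?_) (hs1 i)
        by_contra hxs
        exact hx.2 (mem_iUnion.2 ⟨i, hxs⟩)
      have h2 : volume.withDensity ((spectralMeasure H (e i)).rnDeriv volume) (Aᶜ \ N) = 0 := by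
        rw [withDensity_apply_eq_zero (Measure.measurable_rnDeriv _ _)]
        convert measure_empty (μ := (volume : Measure ℝ))
        refine eq_empty_of_forall_notMem fun x hx => hx.2.1 ⟨i, hx.1⟩
      rw [h1, h2, add_zero]
    have hφ : spectralMeasure H φ (Aᶜ \ N) = 0 :=
      he (spectralNull H (Aᶜ \ N)) (isClosed_spectralNull H _) hB φ
    have h1 : acSpectralMeasure H φ (Aᶜ \ N) = 0 :=
      le_zero_iff.1 ((Measure.withDensity_rnDeriv_le _ _ _).trans hφ.le)
    have h2 : acSpectralMeasure H φ N = 0 := withDensity_absolutelyContinuous _ _ hN0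
    refine measure_mono_null (fun x hx => ?_) (measure_union_null h1 h2)
    by_cases hxN : x ∈ N
    · exact Or.inr hxN
    · exact Or.inl ⟨hx, hxN⟩
  · rw [measure_eq_zero_iff_ae_notMem]
    filter_upwards [ae_all_iff.2 fun i => hT.ae_rnDeriv_eq_zero (e i)] with x hx hxA
    obtain ⟨i, hi⟩ := hxA.1
    exact hi (hx i hxA.2)

end EssentialSupport

theorem mainTheorem7 (w : ℤ → ℂ) (v : ℤ → ℝ)
    (hsymm : ∀ k : ℤ, star (w (-k)) = w k)
    (hdecay : CubicDecay w)
    (hv : ∃ M : ℝ, ∀ n : ℤ, |v n| ≤ M)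
    (S : Set ℝ) (hS : NullMeasurableSet S volume) (hpos : 0 < volume S)
    (hsol : ∀ E ∈ S, ∃ u : ℤ → ℂ, IsBoundedSolution w v E u) :
    (∃ A : Set ℝ, IsACEssentialSupport (longRangeOperator w v hv) A) ∧
      ∀ A : Set ℝ, IsACEssentialSupport (longRangeOperator w v hv) A → volume (S \ A) = 0 := by
  set H := longRangeOperator w v hv with hH
  refine ⟨⟨_, isACEssentialSupport_of_total H (fun n : ℤ => (lp.single 2 n (1 : ℂ) : EllTwo))
    fun V hV h f => mem_of_isClosed_of_single_mem hV h f⟩, fun A hA => ?_⟩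
  rw [measure_eq_zero_iff_ae_notMem]
  have h1 := ae_all_iff.2 fun n : ℤ =>
    hA.1.ae_rnDeriv_eq_zero (lp.single 2 n (1 : ℂ) : EllTwo)
  have h2 := ae_all_iff.2 fun n : ℤ =>
    Besicovitch.ae_tendsto_rnDeriv (spectralMeasure H (lp.single 2 n (1 : ℂ) : EllTwo)) volume
  filter_upwards [h1, h2] with E hE1 hE2 hE
  obtain ⟨u, hu⟩ := hsol E hE.1
  obtain ⟨m, hm⟩ := Function.ne_iff.1 hu.ne_zero
  obtain ⟨c, hc, hlow⟩ := exists_poisson_lower_bound hsymm hdecay hv hu hm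
  have h3 := hE2 m
  rw [hE1 m hE.2] at h3
  obtain ⟨ε, h0, hlt, hε⟩ := exists_poisson_lt_of_tendsto_zero h3 hc
  exact (hlow ε h0 hlt).not_gt hε
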